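/- Let $G$ be an abelian group and $\phi\colon G\to G$ a group endomorphism. For a subgroup $H\le G$ and an integer $n\ge 1$ put $$T_n(\phi,H)=H+\phi(H)+\phi^2(H)+\dots+\phi^{n-1}(H).$$ Call $H$ $\phi$-inert if the quotient $(H+\phi(H))/H$ is finite. For a $\phi$-inert subgroup $H$ all the quotients $T_n(\phi,H)/H$ are finite and the limit $$\widetilde{\mathrm{ent}}(\phi,H)=\lim_{n\to\infty}\frac{\log|T_n(\phi,H)/H|}{n}$$ exists and is finite. The intrinsic algebraic entropy of $\phi$ is $$\widetilde{\mathrm{ent}}(\phi)=\sup\{\widetilde{\mathrm{ent}}(\phi,H)\mid H\text{ a }\phi\text{-inert subgroup of }G\}\in[0,\infty].$$ Logarithmic Law. For every abelian group $G$, every endomorphism $\phi$ of $G$ and every integer $k\ge 1$, $$\widetilde{\mathrm{ent}}(\phi^k)=k\cdot\widetilde{\mathrm{ent}}(\phi),$$ where $k\cdot\infty=\infty$. -/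

import Mathlib

open Filter Topology

namespace IntrinsicEntropy

variable {G : Type*} [AddCommGroup G]

/-- The image `f(H)` of a subgroup `H` under an endomorphism `f`. -/
def image (f : AddMonoid.End G) (H : AddSubgroup G) : AddSubgroup G :=
  H.map (AddMonoidHomClass.toAddMonoidHom f)

/-- The `n`-th partial `φ`-trajectory `H + φ(H) + ⋯ + φ ^ (n - 1)(H)` of the subgroup `H`. -/
def trajectory (φ : AddMonoid.End G) (H : AddSubgroup G) (n : ℕ) : AddSubgroup G :=
  ⨆ i ∈ Finset.range n, image (φ ^ i) H

/-- `H` is `φ`-inert if the quotient `(H + φ(H)) / H` is finite. -/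
def IsInert (φ : AddMonoid.End G) (H : AddSubgroup G) : Prop :=
  Finite ((H ⊔ image φ H : AddSubgroup G) ⧸ H.addSubgroupOf (H ⊔ image φ H))

/-- The order of the quotient `T_n(φ, H) / H`. -/
noncomputable def trajectoryIndex (φ : AddMonoid.End G) (H : AddSubgroup G) (n : ℕ) : ℕ :=
  Nat.card (trajectory φ H n ⧸ H.addSubgroupOf (trajectory φ H n))

/-- The intrinsic entropy of `φ` with respect to `H`, that is, the limit of
`log |T_n(φ, H) / H| / n`. If `H` is `φ`-inert, then all these quotients are finite for `n ≥ 1`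
and the limit exists in `ℝ`: see `finite_quotient` and `tendsto_entropyWrt` below. -/
noncomputable def entropyWrt (φ : AddMonoid.End G) (H : AddSubgroup G) : ℝ :=
  limUnder atTop fun n : ℕ => Real.log (trajectoryIndex φ H n) / n

/-- The intrinsic algebraic entropy of `φ`: the supremum, in the extended reals, of the intrinsic
entropies of `φ` with respect to all `φ`-inert subgroups. -/
noncomputable def entropy (φ : AddMonoid.End G) : EReal :=
  ⨆ H : {H : AddSubgroup G // IsInert φ H}, (entropyWrt φ H.1 : EReal)

theorem trajectoryIndex_eq (φ : AddMonoid.End G) (H : AddSubgroup G) (n : ℕ) :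
    trajectoryIndex φ H n = H.relIndex (trajectory φ H n) := rfl

theorem image_le_trajectory (φ : AddMonoid.End G) (H : AddSubgroup G) {i n : ℕ} (h : i < n) :
    image (φ ^ i) H ≤ trajectory φ H n :=
  le_iSup₂_of_le i (Finset.mem_range.2 h) le_rfl

theorem le_trajectory (φ : AddMonoid.End G) (H : AddSubgroup G) {n : ℕ} (h : 0 < n) :
    H ≤ trajectory φ H n := by
  have := image_le_trajectory φ H h
  rw [pow_zero] at this
  intro x hx
  exact this ⟨x, hx, rfl⟩

theorem trajectory_mono (φ : AddMonoid.End G) (H : AddSubgroup G) {m n : ℕ} (h : m ≤ n) :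
    trajectory φ H m ≤ trajectory φ H n :=
  iSup₂_le fun _ hi => image_le_trajectory φ H ((Finset.mem_range.1 hi).trans_le h)

theorem image_pow_add (φ : AddMonoid.End G) (H : AddSubgroup G) (m i : ℕ) :
    image (φ ^ m) (image (φ ^ i) H) =
      image (φ ^ (m + i)) H := by
  rw [image, image, AddSubgroup.map_map, pow_add]
  rfl

theorem trajectory_add (φ : AddMonoid.End G) (H : AddSubgroup G) (m n : ℕ) :
    trajectory φ H (m + n + 1) =
      image (φ ^ m) (trajectory φ H (n + 1)) ⊔ trajectory φ H (m + 1) := by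
  apply le_antisymm
  · refine iSup₂_le fun i hi => ?_
    have hi := Finset.mem_range.1 hi
    rcases Nat.lt_or_ge i (m + 1) with h | h
    · exact (image_le_trajectory φ H h).trans le_sup_right
    · obtain ⟨j, rfl⟩ := Nat.exists_eq_add_of_le (Nat.le_of_succ_le h)
      rw [← image_pow_add]
      exact (AddSubgroup.map_mono (image_le_trajectory φ H (by omega))).trans le_sup_left
  · refine sup_le ?_ (trajectory_mono φ H (by omega))
    rw [trajectory, image, AddSubgroup.map_iSup]
    refine iSup_le fun i => ?_
    rw [AddSubgroup.map_iSup]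
    refine iSup_le fun hi => ?_
    have hi := Finset.mem_range.1 hi
    refine (image_pow_add φ H m i).le.trans ?_
    exact image_le_trajectory φ H (by omega)

theorem trajectoryIndex_dvd (φ : AddMonoid.End G) (H : AddSubgroup G) (m n : ℕ) :
    trajectoryIndex φ H (m + n + 1) ∣
      trajectoryIndex φ H (m + 1) * trajectoryIndex φ H (n + 1) := by
  simp only [trajectoryIndex_eq]
  rw [← AddSubgroup.relIndex_mul_relIndex _ _ _ (le_trajectory φ H (Nat.succ_pos m))
    (trajectory_mono φ H (by omega : m + 1 ≤ m + n + 1))]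
  refine mul_dvd_mul_left _ ?_
  rw [trajectory_add, AddSubgroup.relIndex_sup_right]
  refine (AddSubgroup.relIndex_dvd_of_le_left _
    (image_le_trajectory φ H (Nat.lt_succ_self m))).trans ?_
  rw [image, image, AddSubgroup.relIndex_map_map,
    ← sup_eq_left.2 (le_trajectory φ H (Nat.succ_pos n)), sup_assoc,
    AddSubgroup.relIndex_sup_right, sup_eq_left.2 (le_trajectory φ H (Nat.succ_pos n))]
  exact AddSubgroup.relIndex_dvd_of_le_left _ le_sup_left

theorem trajectoryIndex_ne_zero {φ : AddMonoid.End G} {H : AddSubgroup G} (h : IsInert φ H)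
    (n : ℕ) : trajectoryIndex φ H (n + 1) ≠ 0 := by
  have h1 : trajectory φ H 1 = H := by
    refine le_antisymm (iSup₂_le fun i hi => ?_) (le_trajectory φ H one_pos)
    obtain rfl : i = 0 := by simpa using hi
    rw [pow_zero]
    rintro _ ⟨x, hx, rfl⟩
    exact hx
  have h2 : trajectory φ H 2 = H ⊔ image φ H := by
    refine le_antisymm ?_ (sup_le (le_trajectory φ H two_pos) ?_)
    · refine iSup₂_le fun i hi => ?_
      have hi := Finset.mem_range.1 hi
      interval_cases i
      · exact (image_le_trajectory φ H one_pos).trans (h1.le.trans le_sup_left)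
      · rw [pow_one]
        exact le_sup_right
    · simpa using image_le_trajectory φ H one_lt_two
  induction n with
  | zero => rw [trajectoryIndex_eq, h1, AddSubgroup.relIndex_self]; exact one_ne_zero
  | succ n ih =>
    refine ne_zero_of_dvd_ne_zero (mul_ne_zero ih ?_) (trajectoryIndex_dvd φ H n 1)
    have := h
    rw [IsInert] at this
    rw [trajectoryIndex_eq, h2]
    exact Nat.card_ne_zero.2 ⟨inferInstance, this⟩

/-- If `H` is `φ`-inert, then `T_n(φ, H) / H` is finite. -/
theorem finite_quotient {φ : AddMonoid.End G} {H : AddSubgroup G} (h : IsInert φ H) (n : ℕ) :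
    Finite (trajectory φ H (n + 1) ⧸ H.addSubgroupOf (trajectory φ H (n + 1))) :=
  Nat.finite_of_card_ne_zero (trajectoryIndex_ne_zero h n)

/-- If `H` is `φ`-inert, then the limit defining `entropyWrt φ H` exists. -/
theorem tendsto_entropyWrt {φ : AddMonoid.End G} {H : AddSubgroup G} (h : IsInert φ H) :
    Tendsto (fun n : ℕ => Real.log (trajectoryIndex φ H n) / n) atTop (𝓝 (entropyWrt φ H)) := by
  apply tendsto_nhds_limUnder
  set u : ℕ → ℝ := fun n => Real.log (trajectoryIndex φ H (n + 1)) with hu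
  have hpos : ∀ n, 0 < (trajectoryIndex φ H (n + 1) : ℝ) := fun n =>
    Nat.cast_pos.2 (Nat.pos_of_ne_zero (trajectoryIndex_ne_zero h n))
  have hsub : Subadditive u := fun m n => by
    simp only [hu]
    rw [← Real.log_mul (hpos m).ne' (hpos n).ne']
    refine Real.log_le_log (hpos _) ?_
    exact_mod_cast Nat.le_of_dvd (Nat.pos_of_ne_zero (mul_ne_zero (trajectoryIndex_ne_zero h m)
      (trajectoryIndex_ne_zero h n))) (trajectoryIndex_dvd φ H m n)
  have hbdd : BddBelow (Set.range fun n : ℕ => u n / n) :=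
    ⟨0, by rintro _ ⟨n, rfl⟩; exact div_nonneg (Real.log_natCast_nonneg _) (Nat.cast_nonneg _)⟩
  refine ⟨hsub.lim, (tendsto_add_atTop_iff_nat 1).1 ?_⟩
  have h1 := (hsub.tendsto_lim hbdd).mul (tendsto_natCast_div_add_atTop (1 : ℝ))
  rw [mul_one] at h1
  refine h1.congr' ?_
  filter_upwards [eventually_gt_atTop 0] with n hn
  have : (n : ℝ) ≠ 0 := Nat.cast_ne_zero.2 hn.ne'
  simp only [hu]
  push_cast
  field_simp

end IntrinsicEntropy

open Filter Topology Polynomial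

namespace IntrinsicEntropy

variable {G : Type*} [AddCommGroup G]

/-! For `≥`, `T_{kn}(φ, H)` lies in `T_n(φ ^ k, T_k(φ, H))`, and passing from `H` to `T_k(φ, H)`
costs a finite index, which vanishes in the limit (`mul_entropyWrt_le_entropyWrt_pow`). For `≤`, a
`φ ^ k`-inert `H` need not be `φ`-inert, so it is replaced by a finitely generated subgroup.
Finitely many coset representatives generate `F` with `φ ^ k (H) ≤ H + F`. If no nonzero integer
polynomial in `φ` kills some `x ∈ F`, then `ℤ[X]` embeds in `G` and `φ` has infinite entropy
(`entropy_eq_top`). Otherwise one nonzero `P(φ)` kills `F`, a finite trajectory `B` of `F` is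
`φ`-inert, and `B` bounds the entropy of `H` (`entropyWrt_le_of_fg`). -/

/-! ### Trajectories and inertness -/

theorem image_mono (f : AddMonoid.End G) {H K : AddSubgroup G} (h : H ≤ K) :
    image f H ≤ image f K := AddSubgroup.map_mono h

theorem image_sup (f : AddMonoid.End G) (H K : AddSubgroup G) :
    image f (H ⊔ K) = image f H ⊔ image f K := AddSubgroup.map_sup _ _ _

theorem image_one (H : AddSubgroup G) : image 1 H = H := AddSubgroup.map_id H

theorem isInert_iff {φ : AddMonoid.End G} {H : AddSubgroup G} :
    IsInert φ H ↔ H.relIndex (image φ H) ≠ 0 := by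
  rw [← AddSubgroup.relIndex_sup_left (image φ H) H]
  exact (AddSubgroup.index_ne_zero_iff_finite
    (H := H.addSubgroupOf (H ⊔ image φ H))).symm

theorem trajectory_zero (φ : AddMonoid.End G) (H : AddSubgroup G) : trajectory φ H 0 = ⊥ := by
  simp [trajectory]

theorem trajectory_succ (φ : AddMonoid.End G) (H : AddSubgroup G) (n : ℕ) :
    trajectory φ H (n + 1) = H ⊔ image φ (trajectory φ H n) := by
  apply le_antisymm
  · refine iSup₂_le fun i hi => ?_
    have hi := Finset.mem_range.1 hi
    cases i with
    | zero => rw [pow_zero, image_one]; exact le_sup_left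
    | succ j =>
      have h := image_pow_add φ H 1 j
      rw [pow_one, add_comm] at h
      rw [← h]
      exact (image_mono φ (image_le_trajectory φ H (by omega))).trans le_sup_right
  · refine sup_le (le_trajectory φ H n.succ_pos) ?_
    cases n with
    | zero =>
      rw [trajectory_zero, image, AddSubgroup.map_bot]
      exact bot_le
    | succ n =>
      have h := trajectory_add φ H 1 n
      rw [pow_one, add_comm 1 n] at h
      rw [h]
      exact le_sup_left

theorem trajectory_succ_eq_sup_image_pow (φ : AddMonoid.End G) (H : AddSubgroup G) (n : ℕ) :
    trajectory φ H (n + 1) = trajectory φ H n ⊔ image (φ ^ n) H := by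
  rw [trajectory, Finset.range_add_one, Finset.iSup_insert, sup_comm, trajectory]

theorem image_trajectory_le (φ : AddMonoid.End G) (H : AddSubgroup G) (n : ℕ) :
    image φ (trajectory φ H n) ≤ trajectory φ H (n + 1) := by
  rw [trajectory_succ]
  exact le_sup_right

theorem trajectory_mono_left (φ : AddMonoid.End G) {H K : AddSubgroup G} (h : H ≤ K) (n : ℕ) :
    trajectory φ H n ≤ trajectory φ K n :=
  iSup₂_mono fun _ _ => image_mono _ h

theorem trajectory_pow_le (φ : AddMonoid.End G) (H : AddSubgroup G) {k : ℕ} (hk : 0 < k) (n : ℕ) :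
    trajectory (φ ^ k) H n ≤ trajectory φ H (k * n) := by
  refine iSup₂_le fun i hi => ?_
  rw [← pow_mul]
  exact image_le_trajectory φ H (Nat.mul_lt_mul_of_pos_left (Finset.mem_range.1 hi) hk)

theorem trajectory_mul_le (φ : AddMonoid.End G) (H : AddSubgroup G) {k : ℕ} (hk : 0 < k) (n : ℕ) :
    trajectory φ H (k * n) ≤ trajectory (φ ^ k) (trajectory φ H k) n := by
  refine iSup₂_le fun i hi => ?_
  have hi := Finset.mem_range.1 hi
  rw [← Nat.div_add_mod i k, ← image_pow_add, pow_mul]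
  exact (image_mono _ (image_le_trajectory φ H (Nat.mod_lt i hk))).trans
    (image_le_trajectory _ _ (Nat.div_lt_of_lt_mul hi))

theorem relIndex_trajectory_ne_zero {φ : AddMonoid.End G} {H : AddSubgroup G} (h : IsInert φ H)
    (n : ℕ) : H.relIndex (trajectory φ H n) ≠ 0 :=
  mt (AddSubgroup.relIndex_eq_zero_of_le_right (trajectory_mono φ H n.le_succ))
    (trajectoryIndex_ne_zero h n)

theorem trajectoryIndex_pos {φ : AddMonoid.End G} {H : AddSubgroup G} (h : IsInert φ H)
    (n : ℕ) : 0 < trajectoryIndex φ H n :=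
  Nat.pos_of_ne_zero (relIndex_trajectory_ne_zero h n)

theorem IsInert.pow {φ : AddMonoid.End G} {H : AddSubgroup G} (h : IsInert φ H) (k : ℕ) :
    IsInert (φ ^ k) H :=
  isInert_iff.2 <| mt (AddSubgroup.relIndex_eq_zero_of_le_right
    (image_le_trajectory φ H k.lt_succ_self)) (relIndex_trajectory_ne_zero h _)

theorem IsInert.trajectory {φ : AddMonoid.End G} {H : AddSubgroup G} (h : IsInert φ H) {k : ℕ}
    (hk : 0 < k) : IsInert φ (trajectory φ H k) :=
  isInert_iff.2 fun h0 => relIndex_trajectory_ne_zero h (k + 1) <|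
    AddSubgroup.relIndex_eq_zero_of_le_left (le_trajectory φ H hk) <|
      AddSubgroup.relIndex_eq_zero_of_le_right (image_trajectory_le φ H k) h0

/-- If the index of `T_{an}(φ, H)` over `H` is bounded by a constant times that of `T_{bn}(ψ, K)`
over `K`, then the entropies are related accordingly. -/
theorem mul_entropyWrt_le {φ ψ : AddMonoid.End G} {H K : AddSubgroup G} (hH : IsInert φ H)
    (hK : IsInert ψ K) {a b C : ℕ} (ha : 0 < a) (hb : 0 < b) (hC : C ≠ 0)
    (h : ∀ n, trajectoryIndex φ H (a * n) ≤ C * trajectoryIndex ψ K (b * n)) :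
    a * entropyWrt φ H ≤ b * entropyWrt ψ K := by
  have key : ∀ {θ : AddMonoid.End G} {L : AddSubgroup G} (_ : IsInert θ L) {c : ℕ} (_ : 0 < c),
      Tendsto (fun n : ℕ => Real.log (trajectoryIndex θ L (c * n)) / n) atTop
        (𝓝 (c * entropyWrt θ L)) := by
    intro θ L hL c hc
    have h1 := ((tendsto_entropyWrt hL).comp
      (tendsto_id.const_mul_atTop' hc : Tendsto (fun n : ℕ => c * n) atTop atTop)).const_mul (c : ℝ)
    refine h1.congr' ?_
    filter_upwards [eventually_gt_atTop 0] with n hn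
    have : (c : ℝ) ≠ 0 := Nat.cast_ne_zero.2 hc.ne'
    simp only [Function.comp_apply]
    push_cast
    field_simp
  -- The constant only contributes `log C / n`, which tends to zero.
  have h2 : Tendsto (fun n : ℕ => Real.log C / n) atTop (𝓝 0) :=
    tendsto_const_div_atTop_nhds_zero_nat _
  have h3 := h2.add (key hK hb)
  rw [zero_add] at h3
  refine le_of_tendsto_of_tendsto' (key hH ha) h3 fun n => ?_
  rw [← add_div, ← Real.log_mul (Nat.cast_ne_zero.2 hC)
    (Nat.cast_ne_zero.2 (trajectoryIndex_pos hK _).ne')]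
  have h4 : (0 : ℝ) < trajectoryIndex φ H (a * n) := Nat.cast_pos.2 (trajectoryIndex_pos hH _)
  gcongr
  exact_mod_cast h n

theorem mul_entropyWrt_le_entropyWrt_pow {φ : AddMonoid.End G} {H : AddSubgroup G}
    (h : IsInert φ H) {k : ℕ} (hk : 0 < k) :
    k * entropyWrt φ H ≤ entropyWrt (φ ^ k) (trajectory φ H k) := by
  have h' := (h.trajectory hk).pow k
  have := mul_entropyWrt_le h h' (a := k) (b := 1) hk one_pos
    (relIndex_trajectory_ne_zero h k) fun n => ?_
  · simpa using this
  -- The join with `T_k` also covers `n = 0`, where the trajectory is `⊥`.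
  · have h1 := AddSubgroup.relIndex_mul_relIndex H (trajectory φ H k) _ (le_trajectory φ H hk)
      (le_sup_left : _ ≤ trajectory φ H k ⊔ trajectory (φ ^ k) (trajectory φ H k) n)
    rw [AddSubgroup.relIndex_sup_left] at h1
    rw [one_mul, trajectoryIndex_eq, trajectoryIndex_eq, h1]
    refine AddSubgroup.relIndex_le_of_le_right
      ((trajectory_mul_le φ H hk n).trans le_sup_right) ?_
    rw [← h1]
    exact mul_ne_zero (relIndex_trajectory_ne_zero h k) (relIndex_trajectory_ne_zero h' n)

/-! ### Isolators and finitely generated subgroups -/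

/-- The subgroup of all elements having a nonzero multiple in `H`. -/
def isolator (H : AddSubgroup G) : AddSubgroup G where
  carrier := {x | ∃ n : ℕ, n ≠ 0 ∧ n • x ∈ H}
  zero_mem' := ⟨1, one_ne_zero, by simp⟩
  add_mem' := by
    rintro x y ⟨m, hm, hx⟩ ⟨n, hn, hy⟩
    refine ⟨m * n, mul_ne_zero hm hn, ?_⟩
    rw [smul_add]
    refine H.add_mem ?_ ?_
    · rw [mul_comm, mul_smul]; exact H.nsmul_mem hx n
    · rw [mul_smul]; exact H.nsmul_mem hy m
  neg_mem' := by
    rintro x ⟨m, hm, hx⟩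
    exact ⟨m, hm, by rw [smul_neg]; exact H.neg_mem hx⟩

theorem le_isolator (H : AddSubgroup G) : H ≤ isolator H :=
  fun x hx => ⟨1, one_ne_zero, by rwa [one_smul]⟩

theorem le_isolator_of_relIndex_ne_zero {H K : AddSubgroup G} (h : H.relIndex K ≠ 0) :
    K ≤ isolator H :=
  fun _ hx => ⟨_, h, H.nsmul_relIndex_mem hx⟩

theorem fg_iff_toIntSubmodule {H : AddSubgroup G} :
    H.FG ↔ (AddSubgroup.toIntSubmodule H).FG :=
  (Submodule.fg_iff_addSubgroup_fg (AddSubgroup.toIntSubmodule H)).symm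

theorem fg_of_le {S B : AddSubgroup G} (hB : B.FG) (h : S ≤ B) : S.FG :=
  fg_iff_toIntSubmodule.2 ((fg_iff_toIntSubmodule.1 hB).of_le h)

theorem fg_map {G' : Type*} [AddCommGroup G'] (f : G →+ G') {H : AddSubgroup G} (hH : H.FG) :
    (H.map f).FG := by
  obtain ⟨s, rfl⟩ := hH
  classical
  exact ⟨s.image f, by rw [Finset.coe_image, AddMonoidHom.map_closure]⟩

/-- The image of `S` in `G ⧸ H` is a finitely generated torsion abelian group. -/
theorem relIndex_ne_zero_of_fg {H S : AddSubgroup G} (hS : S.FG) (h : S ≤ isolator H) :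
    H.relIndex S ≠ 0 := by
  have h1 := AddSubgroup.relIndex_ker S (QuotientAddGroup.mk' H)
  rw [QuotientAddGroup.ker_mk'] at h1
  rw [h1]
  have : AddGroup.FG (S.map (QuotientAddGroup.mk' H)) :=
    (AddGroup.fg_iff_addSubgroup_fg _).2 (fg_map _ hS)
  have : Finite (S.map (QuotientAddGroup.mk' H)) := by
    refine AddCommGroup.finite_of_fg_isAddTorsion _ ?_
    rintro ⟨_, x, hx, rfl⟩
    obtain ⟨n, hn, hnx⟩ := h hx
    rw [isOfFinAddOrder_iff_nsmul_eq_zero]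
    refine ⟨n, Nat.pos_of_ne_zero hn, Subtype.ext ?_⟩
    exact (QuotientAddGroup.eq_zero_iff (n • x)).2 hnx
  exact Nat.card_pos.ne'

theorem fg_trajectory (φ : AddMonoid.End G) {F : AddSubgroup G} (hF : F.FG) (n : ℕ) :
    (trajectory φ F n).FG := by
  induction n with
  | zero => rw [trajectory_zero]; exact AddSubgroup.FG.bot
  | succ n ih => rw [trajectory_succ]; exact hF.sup (fg_map _ ih)

/-! ### Reduction to finitely generated subgroups -/

theorem IsInert.exists_fg {ψ : AddMonoid.End G} {H : AddSubgroup G} (h : IsInert ψ H) :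
    ∃ F : AddSubgroup G, F.FG ∧ F ≤ H ⊔ image ψ H ∧ image ψ H ≤ H ⊔ F := by
  have h1 := AddSubgroup.relIndex_ker (image ψ H) (QuotientAddGroup.mk' H)
  rw [QuotientAddGroup.ker_mk'] at h1
  have h2 : Finite ((image ψ H).map (QuotientAddGroup.mk' H)) :=
    (Nat.card_ne_zero.1 (h1 ▸ isInert_iff.1 h)).2
  -- One representative in `ψ(H)` for each of the finitely many cosets of `H` that it meets.
  obtain ⟨t, ht, hte⟩ := Set.exists_subset_bijOn (image ψ H : Set G) (QuotientAddGroup.mk' H)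
  have ht2 : t.Finite := Set.Finite.of_injOn hte.mapsTo hte.injOn (Set.toFinite
    ((image ψ H).map (QuotientAddGroup.mk' H) : Set (G ⧸ H)))
  refine ⟨AddSubgroup.closure t, ⟨ht2.toFinset, by simp⟩, ?_, fun x hx => ?_⟩
  · exact ((AddSubgroup.closure_le _).2 ht).trans le_sup_right
  · obtain ⟨y, hy, hyx⟩ := hte.surjOn ⟨x, hx, rfl⟩
    have h3 : -y + x ∈ H := QuotientAddGroup.eq.1 hyx
    have h4 := AddSubgroup.add_mem_sup h3 (AddSubgroup.subset_closure hy)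
    rwa [neg_add_eq_sub, sub_add_cancel] at h4


theorem trajectory_le_sup {ψ : AddMonoid.End G} {H F : AddSubgroup G} (h : image ψ H ≤ H ⊔ F)
    (n : ℕ) : trajectory ψ H n ≤ H ⊔ trajectory ψ F n := by
  induction n with
  | zero => rw [trajectory_zero]; exact bot_le
  | succ n ih =>
    rw [trajectory_succ, trajectory_succ ψ F]
    refine sup_le le_sup_left ((image_mono ψ ih).trans ?_)
    rw [image_sup, ← sup_assoc]
    exact sup_le_sup_right h _

/-- Ensures that trajectories of `F` have finite index over an inert `H`, hence lie in its isolator.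
-/
theorem trajectory_le_trajectory_succ {ψ : AddMonoid.End G} {H F : AddSubgroup G}
    (h : F ≤ H ⊔ image ψ H) (n : ℕ) : trajectory ψ F n ≤ trajectory ψ H (n + 1) := by
  induction n with
  | zero => rw [trajectory_zero]; exact bot_le
  | succ n ih =>
    rw [trajectory_succ ψ F, trajectory_succ ψ H (n + 1)]
    refine sup_le (h.trans (sup_le_sup_left (image_mono ψ (le_trajectory ψ H n.succ_pos)) _)) ?_
    exact (image_mono ψ ih).trans le_sup_right

/-- A finitely generated inert subgroup `B` containing `F` computes at least the entropy with
respect to any inert `H` for which `F` generates `H + ψ(H)` over `H`. -/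
theorem entropyWrt_le_of_fg {φ : AddMonoid.End G} {k : ℕ} (hk : 0 < k) {H F B : AddSubgroup G}
    (hH : IsInert (φ ^ k) H) (hF : F ≤ H ⊔ image (φ ^ k) H) (hHF : image (φ ^ k) H ≤ H ⊔ F)
    (hB : IsInert φ B) (hBfg : B.FG) (hFB : F ≤ B) :
    entropyWrt (φ ^ k) H ≤ k * entropyWrt φ B := by
  -- This index serves as the constant because it does not depend on `n`.
  have hC : H.relIndex (B ⊓ isolator H) ≠ 0 :=
    relIndex_ne_zero_of_fg (fg_of_le hBfg inf_le_left) inf_le_right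
  have := mul_entropyWrt_le hH hB (a := 1) one_pos hk hC fun n => ?_
  · simpa using this
  rw [one_mul, trajectoryIndex_eq, trajectoryIndex_eq]
  set K := trajectory (φ ^ k) F n with hK
  have hKH := trajectory_le_trajectory_succ hF n
  have hHK : H.relIndex K ≠ 0 := mt (AddSubgroup.relIndex_eq_zero_of_le_right hKH)
    (relIndex_trajectory_ne_zero hH _)
  have hKB : K ≤ trajectory φ B (k * n) :=
    (trajectory_pow_le φ F hk n).trans (trajectory_mono_left φ hFB _)
  have hBK : B.relIndex K ≠ 0 := mt (AddSubgroup.relIndex_eq_zero_of_le_right hKB)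
    (relIndex_trajectory_ne_zero hB _)
  calc H.relIndex (trajectory (φ ^ k) H n)
      ≤ H.relIndex (H ⊔ K) := AddSubgroup.relIndex_le_of_le_right (trajectory_le_sup hHF n)
          (by rwa [sup_comm, AddSubgroup.relIndex_sup_right])
    _ = H.relIndex K := by rw [sup_comm, AddSubgroup.relIndex_sup_right]
    _ ≤ (H ⊓ B).relIndex K := AddSubgroup.relIndex_le_of_le_left inf_le_left
          (AddSubgroup.relIndex_inf_ne_zero hHK hBK)
    _ = H.relIndex (B ⊓ K) * B.relIndex K := (AddSubgroup.relIndex_inf_mul_relIndex ..).symm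
    _ ≤ H.relIndex (B ⊓ isolator H) * B.relIndex (trajectory φ B (k * n)) :=
        Nat.mul_le_mul
          (AddSubgroup.relIndex_le_of_le_right
            (inf_le_inf_left B (le_isolator_of_relIndex_ne_zero hHK)) hC)
          (AddSubgroup.relIndex_le_of_le_right hKB (relIndex_trajectory_ne_zero hB _))

/-- The trajectory of length `deg P` of a finitely generated subgroup killed by `P(φ)`, with `P`
nonconstant, is inert. -/
theorem isInert_trajectory_of_aeval {φ : AddMonoid.End G} {F : AddSubgroup G} (hF : F.FG)
    {P : ℤ[X]} (hP0 : P ≠ 0) (hP : ∀ x ∈ F, aeval φ P x = 0) :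
    IsInert φ (trajectory φ F P.natDegree) := by
  rw [isInert_iff]
  refine relIndex_ne_zero_of_fg (fg_map _ (fg_trajectory φ hF _)) ?_
  refine (image_trajectory_le φ F _).trans ?_
  rw [trajectory_succ_eq_sup_image_pow]
  refine sup_le (le_isolator _) ?_
  rintro _ ⟨x, hx, rfl⟩
  -- The relation `P(φ)(x) = 0` expresses the leading coefficient times the top power through lower
  -- powers of `φ`.
  refine ⟨P.leadingCoeff.natAbs, by simpa using hP0, ?_⟩
  have h1 := hP x hx
  let ev : AddMonoid.End G →+ G := ⟨⟨fun f => f x, rfl⟩, fun _ _ => rfl⟩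
  replace h1 : ev (aeval φ P) = 0 := h1
  rw [aeval_eq_sum_range, Finset.sum_range_succ, map_add, map_sum] at h1
  have h2 : P.leadingCoeff • (φ ^ P.natDegree) x ∈ trajectory φ F P.natDegree := by
    have h3 : P.leadingCoeff • (φ ^ P.natDegree) x =
        -∑ i ∈ Finset.range P.natDegree, P.coeff i • (φ ^ i) x := by
      rw [eq_neg_iff_add_eq_zero, add_comm]
      exact h1
    rw [h3]
    refine neg_mem (sum_mem fun i hi => zsmul_mem ?_ _)
    exact image_le_trajectory φ F (Finset.mem_range.1 hi) ⟨x, hx, rfl⟩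
  rw [← natCast_zsmul, Int.natCast_natAbs]
  rcases abs_choice P.leadingCoeff with h | h <;> rw [h]
  · exact h2
  · rw [neg_smul]; exact neg_mem h2

theorem exists_aeval_eq_zero {φ : AddMonoid.End G} {F : AddSubgroup G} (hF : F.FG)
    (h : ∀ x ∈ F, ∃ P : ℤ[X], P ≠ 0 ∧ aeval φ P x = 0) :
    ∃ P : ℤ[X], P ≠ 0 ∧ 0 < P.natDegree ∧ ∀ x ∈ F, aeval φ P x = 0 := by
  obtain ⟨t, rfl⟩ := hF
  choose! p hp0 hp using fun x (hx : x ∈ t) => h x (AddSubgroup.subset_closure hx)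
  have h0 : ∏ x ∈ t, p x ≠ 0 := Finset.prod_ne_zero_iff.2 hp0
  -- The factor `X` forces positive degree, so that the trajectory of that length contains `F`.
  refine ⟨X * ∏ x ∈ t, p x, mul_ne_zero X_ne_zero h0, ?_, fun x hx => ?_⟩
  · rw [natDegree_X_mul h0]; exact Nat.succ_pos _
  · induction hx using AddSubgroup.closure_induction with
    | mem x hx =>
      obtain ⟨q, hq⟩ := (Finset.dvd_prod_of_mem p hx).mul_left X
      rw [hq, mul_comm, map_mul]
      exact (congrArg (aeval φ q) (hp x hx)).trans (map_zero (aeval φ q))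
    | zero => exact map_zero _
    | add x y _ _ hx hy => rw [map_add, hx, hy, add_zero]
    | neg x _ hx => rw [map_neg, hx, neg_zero]

/-! ### Infinite entropy from an embedded copy of `ℤ[X]` -/

/-- The polynomials whose coefficients of index at least `n` are divisible by `m`. -/
def coeffDvd (m n : ℕ) : AddSubgroup ℤ[X] where
  carrier := {P | ∀ i, n ≤ i → (m : ℤ) ∣ P.coeff i}
  zero_mem' := by simp
  add_mem' := fun {P Q} hP hQ i hi => by rw [coeff_add]; exact dvd_add (hP i hi) (hQ i hi)
  neg_mem' := fun {P} hP i hi => by rw [coeff_neg]; exact (hP i hi).neg_right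

/-- The `n`-th coefficient modulo `m` maps the larger group onto `ZMod m`, with kernel the smaller
one. -/
theorem relIndex_coeffDvd_succ (m n : ℕ) :
    (coeffDvd m n).relIndex (coeffDvd m (n + 1)) = m := by
  let c : ℤ[X] →+ ZMod m :=
    (Int.castAddHom (ZMod m)).comp (lcoeff ℤ n).toAddMonoidHom
  have hc : ∀ P, c P = ((P.coeff n : ℤ) : ZMod m) := fun _ => rfl
  have h1 : coeffDvd m n = c.ker ⊓ coeffDvd m (n + 1) := by
    ext P
    rw [AddSubgroup.mem_inf, AddMonoidHom.mem_ker, hc, ZMod.intCast_zmod_eq_zero_iff_dvd]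
    refine ⟨fun h => ⟨h n le_rfl, fun i hi => h i (by omega)⟩, fun h i hi => ?_⟩
    rcases hi.eq_or_lt with rfl | hi
    · exact h.1
    · exact h.2 i hi
  have h2 : (coeffDvd m (n + 1)).map c = ⊤ := by
    refine eq_top_iff.2 fun y _ => ?_
    obtain ⟨a, rfl⟩ := ZMod.intCast_surjective y
    refine ⟨monomial n a, fun i hi => ?_, by rw [hc, coeff_monomial, if_pos rfl]⟩
    rw [coeff_monomial, if_neg (by omega)]
    exact dvd_zero _
  rw [h1, AddSubgroup.inf_relIndex_right, AddSubgroup.relIndex_ker, h2, AddSubgroup.card_top,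
    Nat.card_zmod]

theorem coeffDvd_mono (m : ℕ) {a b : ℕ} (h : a ≤ b) : coeffDvd m a ≤ coeffDvd m b :=
  fun _ hP i hi => hP i (h.trans hi)

theorem relIndex_coeffDvd_one (m n : ℕ) :
    (coeffDvd m 1).relIndex (coeffDvd m (n + 1)) = m ^ n := by
  induction n with
  | zero => rw [AddSubgroup.relIndex_self, pow_zero]
  | succ n ih =>
    rw [← AddSubgroup.relIndex_mul_relIndex _ _ _ (coeffDvd_mono m (by omega : 1 ≤ n + 1))
      (coeffDvd_mono m (n + 1).le_succ), ih, relIndex_coeffDvd_succ, pow_succ]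

/-- Evaluation `P ↦ P(φ)(x)`. -/
noncomputable def evalAt (φ : AddMonoid.End G) (x : G) : ℤ[X] →+ G :=
  (AddMonoidHom.eval x).comp (aeval φ : ℤ[X] →ₐ[ℤ] AddMonoid.End G).toAddMonoidHom

theorem evalAt_apply (φ : AddMonoid.End G) (x : G) (P : ℤ[X]) :
    evalAt φ x P = aeval φ P x := rfl

theorem evalAt_X_mul (φ : AddMonoid.End G) (x : G) (P : ℤ[X]) :
    evalAt φ x (X * P) = φ (evalAt φ x P) := by
  rw [evalAt_apply, map_mul, aeval_X]
  rfl

/-- Applying `φ` is multiplication by `X`, which shifts coefficients and so frees just one more of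
them. -/
theorem isInert_map_coeffDvd (φ : AddMonoid.End G) {x : G}
    (hx : Function.Injective (evalAt φ x)) {m : ℕ} (hm : m ≠ 0) :
    IsInert φ ((coeffDvd m 1).map (evalAt φ x)) := by
  have h1 : image φ ((coeffDvd m 1).map (evalAt φ x)) ≤ (coeffDvd m 2).map (evalAt φ x) := by
    rintro _ ⟨_, ⟨P, hP, rfl⟩, rfl⟩
    refine ⟨X * P, fun i hi => ?_, evalAt_X_mul φ x P⟩
    obtain ⟨j, rfl⟩ := Nat.exists_eq_add_of_le' (one_le_two.trans hi)
    rw [coeff_X_mul]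
    exact hP j (by omega)
  rw [isInert_iff]
  refine mt (AddSubgroup.relIndex_eq_zero_of_le_right h1) ?_
  rw [AddSubgroup.relIndex_map_map_of_injective _ _ hx, relIndex_coeffDvd_one, pow_one]
  exact hm

theorem map_coeffDvd_le_trajectory (φ : AddMonoid.End G) (x : G) (m n : ℕ) :
    (coeffDvd m (n + 1)).map (evalAt φ x) ≤
      trajectory φ ((coeffDvd m 1).map (evalAt φ x)) (n + 1) := by
  induction n with
  | zero => exact le_trajectory φ _ one_pos
  | succ n ih =>
    rintro _ ⟨P, hP, rfl⟩
    -- Splitting off the constant term leaves `X` times a polynomial covered by induction.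
    rw [trajectory_succ, ← divX_mul_X_add P, map_add, mul_comm, evalAt_X_mul, sup_comm]
    refine AddSubgroup.add_mem_sup ⟨_, ih ⟨P.divX, fun i hi => ?_, rfl⟩, rfl⟩
      ⟨C (P.coeff 0), fun i hi => ?_, rfl⟩
    · rw [coeff_divX]
      exact hP _ (by omega)
    · rw [coeff_C, if_neg (by omega)]
      exact dvd_zero _

theorem log_le_entropyWrt (φ : AddMonoid.End G) {x : G}
    (hx : Function.Injective (evalAt φ x)) {m : ℕ} (hm : m ≠ 0) :
    Real.log m ≤ entropyWrt φ ((coeffDvd m 1).map (evalAt φ x)) := by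
  have hI := isInert_map_coeffDvd φ hx hm
  have h1 := (tendsto_add_atTop_iff_nat 1).2 (tendsto_entropyWrt hI)
  have h2 := (tendsto_natCast_div_add_atTop (1 : ℝ)).mul_const (Real.log m)
  rw [one_mul] at h2
  refine le_of_tendsto_of_tendsto' h2 h1 fun n => ?_
  have h3 : m ^ n ≤ trajectoryIndex φ ((coeffDvd m 1).map (evalAt φ x)) (n + 1) := by
    rw [← relIndex_coeffDvd_one m n, ← AddSubgroup.relIndex_map_map_of_injective _ _ hx]
    exact AddSubgroup.relIndex_le_of_le_right (map_coeffDvd_le_trajectory φ x m n)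
      (relIndex_trajectory_ne_zero hI _)
  have h4 : (0 : ℝ) < (m : ℝ) ^ n := by positivity
  rw [div_mul_eq_mul_div, ← Real.log_pow]
  push_cast
  gcongr
  exact_mod_cast h3

/-! ### The two inequalities -/

theorem entropyWrt_le_entropy {φ : AddMonoid.End G} {H : AddSubgroup G} (h : IsInert φ H) :
    (entropyWrt φ H : EReal) ≤ entropy φ :=
  le_iSup (fun H : {H : AddSubgroup G // IsInert φ H} => (entropyWrt φ H.1 : EReal)) ⟨H, h⟩

theorem entropy_eq_top {φ : AddMonoid.End G} {x : G} (hx : Function.Injective (evalAt φ x)) :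
    entropy φ = ⊤ := by
  refine EReal.eq_top_iff_forall_lt _ |>.2 fun y => ?_
  have h1 : Tendsto (fun m : ℕ => Real.log m) atTop atTop :=
    Real.tendsto_log_atTop.comp tendsto_natCast_atTop_atTop
  obtain ⟨m, hm, hm0⟩ := ((h1.eventually_gt_atTop y).and (eventually_ne_atTop 0)).exists
  exact (EReal.coe_lt_coe_iff.2 (hm.trans_le (log_le_entropyWrt φ hx hm0))).trans_le
    (entropyWrt_le_entropy (isInert_map_coeffDvd φ hx hm0))

theorem entropy_pow_le (φ : AddMonoid.End G) {k : ℕ} (hk : 0 < k) :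
    entropy (φ ^ k) ≤ (k : EReal) * entropy φ := by
  refine iSup_le fun ⟨H, hH⟩ => ?_
  obtain ⟨F, hFfg, hF, hHF⟩ := hH.exists_fg
  by_cases hx : ∃ x ∈ F, ∀ P : ℤ[X], aeval φ P x = 0 → P = 0
  · obtain ⟨x, -, hx⟩ := hx
    rw [entropy_eq_top ((injective_iff_map_eq_zero (evalAt φ x)).2 hx),
      EReal.mul_top_of_pos (by exact_mod_cast hk)]
    exact le_top
  · push Not at hx
    obtain ⟨P, hP0, hPd, hP⟩ := exists_aeval_eq_zero hFfg
      fun x hxF => (hx x hxF).imp fun _ => And.symm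
    have hB := isInert_trajectory_of_aeval hFfg hP0 hP
    have h1 := entropyWrt_le_of_fg hk hH hF hHF hB (fg_trajectory φ hFfg _)
      (le_trajectory φ F hPd)
    calc (entropyWrt (φ ^ k) H : EReal)
        ≤ ((k * entropyWrt φ (trajectory φ F P.natDegree) : ℝ) : EReal) :=
          EReal.coe_le_coe_iff.2 h1
      _ = (k : EReal) * (entropyWrt φ (trajectory φ F P.natDegree) : EReal) := by
          rw [EReal.coe_mul]; rfl
      _ ≤ _ := mul_le_mul_of_nonneg_left (entropyWrt_le_entropy hB) (by positivity)

theorem le_entropy_pow (φ : AddMonoid.End G) {k : ℕ} (hk : 0 < k) :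
    (k : EReal) * entropy φ ≤ entropy (φ ^ k) := by
  have hk0 : (0 : EReal) < k := by exact_mod_cast hk
  have hkt : (k : EReal) ≠ ⊤ := EReal.coe_ne_top k
  -- Dividing by `k` isolates the supremum, so each `H` can be bounded separately.
  rw [mul_comm, ← EReal.le_div_iff_mul_le hk0 hkt]
  refine iSup_le fun ⟨H, hH⟩ => ?_
  rw [EReal.le_div_iff_mul_le hk0 hkt, mul_comm]
  calc (k : EReal) * (entropyWrt φ H : EReal) = ((k * entropyWrt φ H : ℝ) : EReal) := by
        rw [EReal.coe_mul]; rfl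
    _ ≤ (entropyWrt (φ ^ k) (trajectory φ H k) : EReal) :=
        EReal.coe_le_coe_iff.2 (mul_entropyWrt_le_entropyWrt_pow hH hk)
    _ ≤ _ := entropyWrt_le_entropy ((hH.trajectory hk).pow k)

end IntrinsicEntropy

theorem mainTheorem1 {G : Type*} [AddCommGroup G] (φ : AddMonoid.End G) (k : ℕ) (hk : 0 < k) :
    IntrinsicEntropy.entropy (φ ^ k) = (k : EReal) * IntrinsicEntropy.entropy φ :=
  le_antisymm (IntrinsicEntropy.entropy_pow_le φ hk) (IntrinsicEntropy.le_entropy_pow φ hk)
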